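/- Let $X$, $Y$, $Z$ be Banach spaces (all real or all complex), where $X$ is separable and reflexive. Let $\mathcal L$ be a collection of bounded linear operators $L : X \to Y$, equipped with a $\sigma$-compact, locally compact Hausdorff topology such that for every $x \in X$ the map $\mathcal L \to Y$, $L \mapsto Lx$, is continuous. Put $$M = \Big\{x \in X : \|x\|_M := \sup_{L \in \mathcal L}\|Lx\|_Y < \infty\Big\}, \qquad M_0 = \Big\{x \in M : \lim_{\mathcal L \ni L \to \infty}\|Lx\|_Y = 0\Big\},$$ where $L \to \infty$ means that $L$ escapes all compact subsets of $\mathcal L$, and both spaces carry $\|\cdot\|_M$. Assume that (a) $\|\cdot\|_M$ is a norm on $M$ that is stronger than the $X$-norm, i.e. there is a constant $C$ with $\|x\|_X \le C\|x\|_M$ for all $x \in M$; (b) for every $x \in M$ there is a sequence $(x_n)$ in $M_0$ with $\sup_n \|x_n\|_M < \infty$ that converges to $x$ weakly in $X$. Let $J : X^* \to M_0^*$ be the restriction of functionals to $M_0$, and let $I : M_0^{**} \to X^{**} = X$ be its adjoint; under the above assumptions $I$ is an isomorphism of $M_0^{**}$ onto $M$ that is the identity on $M_0$. The weak$^*$ topology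 of $M$ is the weak$^*$ topology of $M_0^{**} = (M_0^*)^*$ transported to $M$ by $I$. Let $T : M \to Z$ be a bounded linear operator that is continuous from the weak$^*$ topology of $M$ to the weak topology of $Z$. Then $T$ is weakly compact (the image of the closed unit ball of $M$ is relatively weakly compact in $Z$) if and only if for every $\varepsilon > 0$ there exists $N > 0$ such that $$\|Tx\|_Z \le N\|x\|_X + \varepsilon\|x\|_M \qquad \text{for all } x \in M.$$ -/

import Mathlib

open Filter Topology

noncomputable section

namespace OOSpace

section Spaces

variable {𝕜 X Y Λ : Type*} [RCLike 𝕜]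
  [NormedAddCommGroup X] [NormedSpace 𝕜 X] [NormedAddCommGroup Y] [NormedSpace 𝕜 Y]

/-- The vectors `x` of `X` with `sup_l ‖L l x‖ < ∞`, as a linear subspace of `X`. The collection of
operators is given as a family `L` indexed by a type `Λ`, which later carries its topology; a set
of operators is the case where `L` is the inclusion of that set. -/
def bigOSubmodule (L : Λ → X →L[𝕜] Y) : Submodule 𝕜 X where
  carrier := {x | BddAbove (Set.range fun l => ‖L l x‖)}
  zero_mem' := ⟨0, by rintro _ ⟨l, rfl⟩; simp⟩
  add_mem' := by
    rintro x y ⟨a, ha⟩ ⟨b, hb⟩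
    refine ⟨a + b, ?_⟩
    rintro _ ⟨l, rfl⟩
    have h1 : ‖L l x‖ ≤ a := ha ⟨l, rfl⟩
    have h2 : ‖L l y‖ ≤ b := hb ⟨l, rfl⟩
    simp only [map_add]
    exact (norm_add_le _ _).trans (add_le_add h1 h2)
  smul_mem' := by
    rintro c x ⟨a, ha⟩
    refine ⟨‖c‖ * a, ?_⟩
    rintro _ ⟨l, rfl⟩
    have h1 : ‖L l x‖ ≤ a := ha ⟨l, rfl⟩
    simp only [map_smul, norm_smul]
    exact mul_le_mul_of_nonneg_left h1 (norm_nonneg c)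

/-- `‖x‖_M = sup_l ‖L l x‖`, on the subspace where it is finite. -/
def bigONorm (L : Λ → X →L[𝕜] Y) : Seminorm 𝕜 (bigOSubmodule L) :=
  Seminorm.of (fun x => ⨆ l, ‖L l x‖)
    (fun x y => by
      refine Real.iSup_le (fun l => ?_) (add_nonneg (Real.iSup_nonneg fun _ => norm_nonneg _)
        (Real.iSup_nonneg fun _ => norm_nonneg _))
      simp only [Submodule.coe_add, map_add]
      exact (norm_add_le _ _).trans (add_le_add (le_ciSup x.2 l) (le_ciSup y.2 l)))
    (fun c x => by
      simp only [Submodule.coe_smul, map_smul, norm_smul]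
      exact (Real.mul_iSup_of_nonneg (norm_nonneg c) _).symm)

/-- The space `M(X, L)`. It is a type of its own, so that it does not inherit the norm of `X`. -/
def BigO (L : Λ → X →L[𝕜] Y) : Type _ := bigOSubmodule L

variable (L : Λ → X →L[𝕜] Y)

/-- `M(X, L)` with the norm `‖·‖_M`. In general this is a seminorm; it is a norm as soon as it
dominates the norm of `X`. -/
instance : SeminormedAddCommGroup (BigO L) :=
  @AddGroupSeminorm.toSeminormedAddCommGroup (bigOSubmodule L) _ (bigONorm L).toAddGroupSeminorm

instance : NormedSpace 𝕜 (BigO L) where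
  toModule := inferInstanceAs (Module 𝕜 (bigOSubmodule L))
  norm_smul_le c x := (map_smul_eq_mul (bigONorm L) c x).le

/-- The inclusion of `M(X, L)` in `X`. -/
def BigO.toX : BigO L →ₗ[𝕜] X := (bigOSubmodule L).subtype

lemma BigO.norm_def (x : BigO L) : ‖x‖ = ⨆ l, ‖L l (BigO.toX L x)‖ := rfl

variable {L} in
lemma BigO.bddAbove (x : BigO L) : BddAbove (Set.range fun l => ‖L l (BigO.toX L x)‖) :=
  x.2

variable {L} in
lemma BigO.le_norm (x : BigO L) (l : Λ) : ‖L l (BigO.toX L x)‖ ≤ ‖x‖ :=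
  le_ciSup x.bddAbove l

/-- The norm of `M(X, L)` is stronger than the norm of `X`. -/
def NormStronger : Prop := ∃ C : ℝ, ∀ x : BigO L, ‖BigO.toX L x‖ ≤ C * ‖x‖

/-- The space `M₀(X, L)`: the vectors `x` of `M(X, L)` such that `‖L l x‖ → 0` as `l` escapes all
compact sets. It carries the norm of `M(X, L)`. -/
def littleO [TopologicalSpace Λ] : Submodule 𝕜 (BigO L) where
  carrier := {x | Tendsto (fun l => ‖L l (BigO.toX L x)‖) (cocompact Λ) (𝓝 0)}
  zero_mem' := by simpa using tendsto_const_nhds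
  add_mem' := by
    intro x y hx hy
    refine squeeze_zero (fun _ => norm_nonneg _) (fun l => ?_) (by simpa using hx.add hy)
    simp only [map_add]
    exact norm_add_le _ _
  smul_mem' := by
    intro c x hx
    simpa [norm_smul] using hx.const_mul ‖c‖

/-- Every `x` in `M(X, L)` is the limit, weakly in `X`, of a sequence in `M₀(X, L)` that is bounded
in the norm of `M(X, L)`. -/
def Approximation [TopologicalSpace Λ] : Prop :=
  ∀ x : BigO L, ∃ u : ℕ → littleO L, (∃ B : ℝ, ∀ n, ‖u n‖ ≤ B) ∧
    Tendsto (fun n => toWeakSpace 𝕜 X (BigO.toX L (u n))) atTop (𝓝 (toWeakSpace 𝕜 X (BigO.toX L x)))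

end Spaces

/-- Reflexivity: the canonical embedding in the bidual is onto. -/
def Reflexive (𝕜 X : Type*) [RCLike 𝕜] [NormedAddCommGroup X] [NormedSpace 𝕜 X] : Prop :=
  Function.Surjective (NormedSpace.inclusionInDoubleDual 𝕜 X)

/-- The canonical isometric isomorphism `X ≃ X**` of a reflexive space. -/
def Reflexive.equiv {𝕜 X : Type*} [RCLike 𝕜] [NormedAddCommGroup X] [NormedSpace 𝕜 X]
    (hX : Reflexive 𝕜 X) : X ≃ₗᵢ[𝕜] StrongDual 𝕜 (StrongDual 𝕜 X) :=
  LinearIsometryEquiv.ofSurjective (NormedSpace.inclusionInDoubleDualLi 𝕜) hX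

section Bidual

variable {𝕜 X Y Λ : Type*} [RCLike 𝕜]
  [NormedAddCommGroup X] [NormedSpace 𝕜 X] [NormedAddCommGroup Y] [NormedSpace 𝕜 Y]
  [TopologicalSpace Λ] {L : Λ → X →L[𝕜] Y}

/-- The inclusion `M₀(X, L) → X`, as a bounded operator. -/
def littleOToX (hL : NormStronger L) : littleO L →L[𝕜] X :=
  ((BigO.toX L).comp (littleO L).subtype).mkContinuousOfExistsBound
    (hL.imp fun _ hC x => hC x)

/-- `J : X* → M₀*`, the restriction of functionals to `M₀(X, L)`. -/
def restrictDual (hL : NormStronger L) : StrongDual 𝕜 X →L[𝕜] StrongDual 𝕜 (littleO L) :=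
  ContinuousLinearMap.precomp 𝕜 (littleOToX hL)

/-- `I : M₀** → X`, the adjoint of `J`, where `X** = X` by reflexivity. -/
def bidualToX (hX : Reflexive 𝕜 X) (hL : NormStronger L) :
    StrongDual 𝕜 (StrongDual 𝕜 (littleO L)) →L[𝕜] X :=
  (hX.equiv.symm.toContinuousLinearEquiv :
      StrongDual 𝕜 (StrongDual 𝕜 X) →L[𝕜] X).comp
    (ContinuousLinearMap.precomp 𝕜 (restrictDual hL))

lemma apply_bidualToX (hX : Reflexive 𝕜 X) (hL : NormStronger L)
    (m : StrongDual 𝕜 (StrongDual 𝕜 (littleO L))) (f : StrongDual 𝕜 X) :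
    f (bidualToX hX hL m) = m (restrictDual hL f) := by
  have h : hX.equiv (bidualToX hX hL m) = ContinuousLinearMap.precomp 𝕜 (restrictDual hL) m :=
    hX.equiv.apply_symm_apply _
  exact congrArg (fun F : StrongDual 𝕜 (StrongDual 𝕜 X) => F f) h

lemma norm_apply_bidualToX_le (hX : Reflexive 𝕜 X) (hL : NormStronger L)
    (m : StrongDual 𝕜 (StrongDual 𝕜 (littleO L))) (l : Λ) :
    ‖L l (bidualToX hX hL m)‖ ≤ ‖m‖ := by
  refine NormedSpace.norm_le_dual_bound 𝕜 _ (norm_nonneg m) fun g => ?_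
  have h := apply_bidualToX hX hL m (g.comp (L l))
  rw [ContinuousLinearMap.comp_apply] at h
  rw [h]
  refine (m.le_opNorm _).trans (mul_le_mul_of_nonneg_left ?_ (norm_nonneg m))
  refine ContinuousLinearMap.opNorm_le_bound _ (norm_nonneg g) fun x => ?_
  exact (g.le_opNorm _).trans
    (mul_le_mul_of_nonneg_left (BigO.le_norm (x : BigO L) l) (norm_nonneg g))

/-- The map `I`, which has its values in `M(X, L)`, as a map `M₀** → M(X, L)`. -/
def bidualToBigO (hX : Reflexive 𝕜 X) (hL : NormStronger L) :
    StrongDual 𝕜 (StrongDual 𝕜 (littleO L)) →ₗ[𝕜] BigO L :=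
  LinearMap.codRestrict (bigOSubmodule L) (bidualToX hX hL).toLinearMap fun m =>
    ⟨‖m‖, by rintro _ ⟨l, rfl⟩; exact norm_apply_bidualToX_le hX hL m l⟩

/-- The weak* topology of `M(X, L)`: the weak* topology of `M₀**` (as the dual of `M₀*`)
transported along `I : M₀** → M(X, L)`. -/
@[reducible]
def weakStarTopology (hX : Reflexive 𝕜 X) (hL : NormStronger L) : TopologicalSpace (BigO L) :=
  TopologicalSpace.coinduced
    (fun m : WeakDual 𝕜 (StrongDual 𝕜 (littleO L)) =>
      bidualToBigO hX hL (WeakDual.toStrongDual m))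
    inferInstance

end Bidual

/-- An operator is weakly compact if the image of the closed unit ball is relatively compact in the
weak topology. -/
def WeaklyCompact {𝕜 E Z : Type*} [RCLike 𝕜] [SeminormedAddCommGroup E] [NormedSpace 𝕜 E]
    [NormedAddCommGroup Z] [NormedSpace 𝕜 Z] (T : E →L[𝕜] Z) : Prop :=
  IsCompact (closure ((fun x => toWeakSpace 𝕜 Z (T x)) '' Metric.closedBall (0 : E) 1))

/-- Weak*-weak continuity of a map from `M(X, L)` to `Z`. -/
def WeakStarWeakContinuous {𝕜 X Y Z Λ : Type*} [RCLike 𝕜]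
    [NormedAddCommGroup X] [NormedSpace 𝕜 X] [NormedAddCommGroup Y] [NormedSpace 𝕜 Y]
    [NormedAddCommGroup Z] [NormedSpace 𝕜 Z] [TopologicalSpace Λ] {L : Λ → X →L[𝕜] Y}
    (hX : Reflexive 𝕜 X) (hL : NormStronger L) (T : BigO L →L[𝕜] Z) : Prop :=
  @Continuous (BigO L) (WeakSpace 𝕜 Z) (weakStarTopology hX hL) inferInstance
    (fun x => toWeakSpace 𝕜 Z (T x))

end OOSpace

end

noncomputable section

namespace OOSpace

open Metric Set

/-! Let `W` be the closure in `X` of the unit ball of `M₀` (`closedUnitBall`). Approximation and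
Baire show that `W` contains a ball of `M` (`exists_closedBall_subset_closedUnitBall`). Also `W`
lies in the image under `I` of the unit ball of `M₀**`, so weak*-weak continuity and weak*
compactness give weak compactness of `T`.

For the estimate, `T` has separable range on `W`. Cover `W` by the countably many sets where `T` is
close to a given point of a dense set; weak* compactness makes them closed in `X`, so Baire yields
`u₀` in the unit ball of `M₀` near which `T` oscillates little (`exists_norm_sub_le`). A vector `u`
of the unit ball of `M₀` that is small in `X` is almost disjoint from `u₀` (`exists_norm_add_le`),
so `u₀ + u` is nearly in the unit ball. Comparing `T` at rescalings of `u₀ + u` and `u₀` shows that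
`T u` is small (`exists_norm_le`). This bound passes to `W` by weak* compactness, then to `M` by
scaling. -/

/-- Baire category theorem in a nonempty closed subset of a complete metric space. -/
lemma exists_ball_inter_subset_of_isClosed_cover {X ι : Type*} [PseudoMetricSpace X]
    [CompleteSpace X] [Countable ι] {A : Set X} (hA : IsClosed A) (hne : A.Nonempty)
    {F : ι → Set X} (hF : ∀ i, IsClosed (F i)) (hAF : A ⊆ ⋃ i, F i) :
    ∃ i, ∃ a ∈ A, ∃ δ > 0, ball a δ ∩ A ⊆ F i := by
  have := hA.completeSpace_coe
  have := hne.to_subtype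
  obtain ⟨i, a, ha⟩ := nonempty_interior_of_iUnion_of_closed
    (f := fun i => ((↑) : A → X) ⁻¹' F i) (fun i => (hF i).preimage continuous_subtype_val)
    (eq_univ_of_forall fun a => by simpa using hAF a.2)
  obtain ⟨δ, hδ, h⟩ := Metric.mem_nhds_iff.1 (mem_interior_iff_mem_nhds.1 ha)
  exact ⟨i, a, a.2, δ, hδ, fun x hx => @h ⟨x, hx.2⟩ hx.1⟩

/-- A closed convex set is weakly closed. -/
lemma isClosed_toWeakSpace_image {𝕜 E : Type*} [RCLike 𝕜] [NormedAddCommGroup E]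
    [NormedSpace 𝕜 E] [NormedSpace ℝ E] [IsScalarTower ℝ 𝕜 E] {s : Set E} (hs : Convex ℝ s)
    (hc : IsClosed s) : IsClosed (toWeakSpace 𝕜 E '' s) := by
  rw [← closure_eq_iff_isClosed, ← hs.toWeakSpace_closure 𝕜, hc.closure_eq]

lemma isClosed_toWeakSpace_closedBall (𝕜 : Type*) {E : Type*} [RCLike 𝕜] [NormedAddCommGroup E]
    [NormedSpace 𝕜 E] (z : E) (r : ℝ) : IsClosed (toWeakSpace 𝕜 E '' closedBall z r) := by
  let _ : NormedSpace ℝ E := NormedSpace.restrictScalars ℝ 𝕜 E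
  have : IsScalarTower ℝ 𝕜 E := RestrictScalars.isScalarTower ℝ 𝕜 E
  exact isClosed_toWeakSpace_image (convex_closedBall z r) isClosed_closedBall

lemma isClosed_toWeakSpace_submodule {𝕜 E : Type*} [RCLike 𝕜] [NormedAddCommGroup E]
    [NormedSpace 𝕜 E] (S : Submodule 𝕜 E) (hS : IsClosed (S : Set E)) :
    IsClosed (toWeakSpace 𝕜 E '' S) := by
  let _ : NormedSpace ℝ E := NormedSpace.restrictScalars ℝ 𝕜 E
  have : IsScalarTower ℝ 𝕜 E := RestrictScalars.isScalarTower ℝ 𝕜 E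
  exact isClosed_toWeakSpace_image (S.restrictScalars ℝ).convex hS

/-! ### The unit ball of `M₀` and its closure in `X` -/

section Ball

variable {𝕜 X Y Λ : Type*} [RCLike 𝕜]
  [NormedAddCommGroup X] [NormedSpace 𝕜 X] [NormedAddCommGroup Y] [NormedSpace 𝕜 Y]
  (L : Λ → X →L[𝕜] Y)

lemma BigO.toX_injective : Function.Injective (BigO.toX L) := Subtype.val_injective

variable {L}

lemma BigO.norm_le {x : BigO L} {r : ℝ} (hr : 0 ≤ r) (h : ∀ l, ‖L l (BigO.toX L x)‖ ≤ r) :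
    ‖x‖ ≤ r :=
  Real.iSup_le h hr

/-- A vector of `X` at which all the operators are bounded by `r` comes from the ball of radius `r`
of `M(X, L)`. -/
lemma BigO.exists_toX_eq {x : X} {r : ℝ} (hr : 0 ≤ r) (h : ∀ l, ‖L l x‖ ≤ r) :
    ∃ y : BigO L, BigO.toX L y = x ∧ ‖y‖ ≤ r := by
  let y : BigO L := (⟨x, r, by rintro _ ⟨l, rfl⟩; exact h l⟩ : bigOSubmodule L)
  exact ⟨y, rfl, BigO.norm_le hr h⟩

variable [TopologicalSpace Λ]

/-- The operators `L l` are uniformly bounded on compact sets of indices. -/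
lemma exists_norm_le_of_isCompact [CompleteSpace X] (hcont : ∀ x : X, Continuous fun l => L l x)
    {K : Set Λ} (hK : IsCompact K) : ∃ C : ℝ, 0 < C ∧ ∀ l ∈ K, ‖L l‖ ≤ C := by
  obtain ⟨C, hC⟩ := banach_steinhaus (g := fun l : K => L l) fun x => by
    obtain ⟨C, hC⟩ := hK.exists_bound_of_continuousOn (hcont x).continuousOn
    exact ⟨C, fun l => hC l l.2⟩
  exact ⟨max C 1, by positivity, fun l hl => (hC ⟨l, hl⟩).trans (le_max_left _ _)⟩

/-- A vector of the unit ball of `M₀` and a vector of the unit ball of `M` that is small in `X` are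
almost disjoint: the norm of their sum is at most slightly larger than `1`. -/
lemma exists_norm_add_le [CompleteSpace X] (hcont : ∀ x : X, Continuous fun l => L l x)
    (u : littleO L) (hu : ‖u‖ ≤ 1) {η : ℝ} (hη : 0 < η) :
    ∃ δ > 0, ∀ x : BigO L, ‖x‖ ≤ 1 → ‖BigO.toX L x‖ < δ → ‖(u : BigO L) + x‖ ≤ 1 + η := by
  have hev : ∀ᶠ l in cocompact Λ, ‖L l (BigO.toX L u)‖ < η :=
    (u.2 : Tendsto _ _ _).eventually (gt_mem_nhds hη)
  obtain ⟨K, hK, hKu⟩ := mem_cocompact.1 hev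
  obtain ⟨C, hC0, hC⟩ := exists_norm_le_of_isCompact hcont hK
  refine ⟨η / C, by positivity, fun x hx hxδ => BigO.norm_le (by positivity) fun l => ?_⟩
  rw [map_add, map_add]
  refine (norm_add_le _ _).trans ?_
  -- On `K` the term with `x` is at most `η`; off `K` the term with `u` is.
  by_cases hl : l ∈ K
  · have h1 := (BigO.le_norm (u : BigO L) l).trans hu
    have h2 : ‖L l (BigO.toX L x)‖ ≤ C * (η / C) :=
      ((L l).le_opNorm _).trans (mul_le_mul (hC l hl) hxδ.le (norm_nonneg _) hC0.le)
    rw [mul_div_cancel₀ _ hC0.ne'] at h2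
    exact add_le_add h1 h2
  · have h1 : ‖L l (BigO.toX L u)‖ < η := hKu hl
    have h2 := (BigO.le_norm x l).trans hx
    linarith

variable (L) in
/-- The closure in `X` of the unit ball of `M₀`. -/
def closedUnitBall : Set X :=
  closure ((fun u : littleO L => BigO.toX L u) '' closedBall 0 1)

lemma toX_mem_closedUnitBall {u : littleO L} (hu : ‖u‖ ≤ 1) :
    BigO.toX L u ∈ closedUnitBall L :=
  subset_closure ⟨u, by simpa using hu, rfl⟩

/-- Absolute convexity passes to closures. Scalars of any sign are allowed because differences of
points are needed as well as convex combinations. -/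
lemma smul_add_smul_mem_closedUnitBall {x y : X} (hx : x ∈ closedUnitBall L)
    (hy : y ∈ closedUnitBall L) {a b : 𝕜} (hab : ‖a‖ + ‖b‖ ≤ 1) :
    a • x + b • y ∈ closedUnitBall L := by
  refine map_mem_closure₂ (f := fun x y => a • x + b • y) (by fun_prop) hx hy ?_
  rintro _ ⟨u, hu, rfl⟩ _ ⟨v, hv, rfl⟩
  refine ⟨a • u + b • v, ?_, by simp⟩
  simp only [mem_closedBall, dist_zero_right] at hu hv ⊢
  calc ‖a • u + b • v‖ ≤ ‖a‖ * ‖u‖ + ‖b‖ * ‖v‖ :=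
        (norm_add_le _ _).trans (add_le_add (norm_smul_le _ _) (norm_smul_le _ _))
    _ ≤ ‖a‖ * 1 + ‖b‖ * 1 := by gcongr
    _ ≤ 1 := by simpa using hab

lemma isClosed_toWeakSpace_closedUnitBall :
    IsClosed (toWeakSpace 𝕜 X '' closedUnitBall L) := by
  let _ : NormedSpace ℝ X := NormedSpace.restrictScalars ℝ 𝕜 X
  have : IsScalarTower ℝ 𝕜 X := RestrictScalars.isScalarTower ℝ 𝕜 X
  refine isClosed_toWeakSpace_image (fun x hx y hy a b ha hb hab => ?_) isClosed_closure
  rw [RCLike.real_smul_eq_coe_smul (K := 𝕜) a, RCLike.real_smul_eq_coe_smul (K := 𝕜) b]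
  exact smul_add_smul_mem_closedUnitBall hx hy
    (by simp [abs_of_nonneg ha, abs_of_nonneg hb, hab])

/-- Under the approximation property a multiple of the unit ball of `M` lies in the closure in `X`
of the unit ball of `M₀`. -/
lemma exists_closedBall_subset_closedUnitBall [CompleteSpace X] (hL : NormStronger L)
    (happrox : Approximation L) :
    ∃ r > 0, ∀ x : BigO L, ‖x‖ ≤ r → BigO.toX L x ∈ closedUnitBall L := by
  obtain ⟨C, hC⟩ := hL
  let A : Set X := {x | ∀ l, ‖L l x‖ ≤ 1}
  have hA : IsClosed A := by
    simp only [A, ofPred_forall]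
    exact isClosed_iInter fun l => isClosed_le (by fun_prop) continuous_const
  -- `A` is the unit ball of `M` seen in `X`, and `F n` is the dilate of `closedUnitBall L` by `n +
  -- 1`. Boundedness of the approximating sequence makes these dilates cover `A`.
  let F : ℕ → Set X := fun n => {x | ((n : 𝕜) + 1)⁻¹ • x ∈ closedUnitBall L}
  have hF : ∀ n, IsClosed (F n) := fun n => isClosed_closure.preimage (continuous_const_smul _)
  have hcover : A ⊆ ⋃ n, F n := by
    intro x hx
    obtain ⟨y, rfl, -⟩ := BigO.exists_toX_eq zero_le_one hx
    obtain ⟨u, ⟨B, hB⟩, hu⟩ := happrox y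
    obtain ⟨n, hn⟩ := exists_nat_ge B
    refine mem_iUnion.2 ⟨n, ?_⟩
    have hlim := hu.const_smul ((n : 𝕜) + 1)⁻¹
    have hmem := isClosed_toWeakSpace_closedUnitBall (L := L) |>.mem_of_tendsto hlim <|
      Eventually.of_forall fun k => ?_
    · rw [← map_smul] at hmem
      exact ((toWeakSpace 𝕜 X).injective.mem_set_image (s := closedUnitBall L)).1 hmem
    · refine ⟨BigO.toX L (((n : 𝕜) + 1)⁻¹ • u k : littleO L), toX_mem_closedUnitBall ?_, by simp⟩
      have h1 : ‖((n : 𝕜) + 1)⁻¹‖ = ((n : ℝ) + 1)⁻¹ := by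
        rw [norm_inv]; norm_cast
      rw [norm_smul, h1, inv_mul_le_one₀ (by positivity)]
      exact (hB k).trans (hn.trans (by simp))
  obtain ⟨n, a, ha, δ, hδ, hsub⟩ := exists_ball_inter_subset_of_isClosed_cover hA
    ⟨0, fun l => by simp⟩ hF hcover
  have hAC : ∀ x ∈ A, ‖x‖ ≤ max C 1 := fun x hx => by
    obtain ⟨y, rfl, hy⟩ := BigO.exists_toX_eq zero_le_one hx
    calc ‖BigO.toX L y‖ ≤ C * ‖y‖ := hC y
      _ ≤ max C 1 * 1 := mul_le_mul (le_max_left _ _) hy (norm_nonneg _) (by positivity)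
      _ = max C 1 := mul_one _
  -- `A` has diameter at most `2 * max C 1` in `X`, so contracting `A` towards `a` with ratio `t`
  -- puts it in the ball of radius `δ`.
  obtain ⟨t, ht0, ht1, ht⟩ : ∃ t : ℝ, 0 < t ∧ t ≤ 1 ∧ t * (2 * max C 1) < δ := by
    refine ⟨min 1 (δ / (4 * max C 1)), by positivity, min_le_left _ _, ?_⟩
    calc min 1 (δ / (4 * max C 1)) * (2 * max C 1)
        ≤ δ / (4 * max C 1) * (2 * max C 1) := by gcongr; exact min_le_right _ _
      _ = δ / 2 := by field_simp; norm_num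
      _ < δ := half_lt_self hδ
  have hseg : ∀ y ∈ A, (((1 - t : ℝ) : 𝕜) • a + ((t : ℝ) : 𝕜) • y) ∈ F n := by
    refine fun y hy => hsub ⟨?_, fun l => ?_⟩
    · have h : (((1 - t : ℝ) : 𝕜) • a + ((t : ℝ) : 𝕜) • y) - a = (t : 𝕜) • (y - a) := by
        push_cast; module
      rw [mem_ball, dist_eq_norm, h, norm_smul, RCLike.norm_of_nonneg ht0.le]
      refine lt_of_le_of_lt ?_ ht
      have := (norm_sub_le y a).trans (add_le_add (hAC y hy) (hAC a ha))
      gcongr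
      linarith
    · rw [map_add, map_smul, map_smul]
      refine (norm_add_le _ _).trans ?_
      rw [norm_smul, norm_smul, RCLike.norm_of_nonneg ht0.le,
        RCLike.norm_of_nonneg (sub_nonneg.2 ht1)]
      nlinarith [ha l, hy l]
  -- Half the difference of the contractions of `y` and `0`, divided by `n + 1`, is `r • y`; the
  -- center `a` cancels.
  let r : ℝ := t * ((n : ℝ) + 1)⁻¹ / 2
  have hr : 0 < r := by positivity
  refine ⟨r, hr, fun x hx => ?_⟩
  have hy : ((r : ℝ) : 𝕜)⁻¹ • BigO.toX L x ∈ A := fun l => by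
    rw [map_smul, norm_smul, norm_inv, RCLike.norm_of_nonneg hr.le, inv_mul_le_one₀ hr]
    exact (BigO.le_norm x l).trans hx
  have h0 : (0 : X) ∈ A := fun l => by simp
  have key := smul_add_smul_mem_closedUnitBall (hseg _ hy) (hseg _ h0) (a := (2 : 𝕜)⁻¹)
    (b := -(2 : 𝕜)⁻¹) (by norm_num)
  convert key using 1
  have hr' : ((r : ℝ) : 𝕜) ≠ 0 := by exact_mod_cast hr.ne'
  have hrt : (2 : 𝕜)⁻¹ * ((n : 𝕜) + 1)⁻¹ * t = r := by
    simp only [r]; push_cast; ring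
  rw [smul_zero, add_zero, smul_add, smul_add, neg_smul, add_neg_cancel_comm, smul_smul, smul_smul,
    smul_smul, hrt, mul_inv_cancel₀ hr', one_smul]

end Ball

/-! ### Weak* compactness and the smallness of `T` on `M₀` -/

section WeakStar

variable {𝕜 X Y Z Λ : Type*} [RCLike 𝕜]
  [NormedAddCommGroup X] [NormedSpace 𝕜 X] [NormedAddCommGroup Y] [NormedSpace 𝕜 Y]
  [NormedAddCommGroup Z] [NormedSpace 𝕜 Z] [TopologicalSpace Λ] {L : Λ → X →L[𝕜] Y}

lemma continuous_toWeakSpace_bidualToX (hX : Reflexive 𝕜 X) (hL : NormStronger L) :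
    Continuous fun m : WeakDual 𝕜 (StrongDual 𝕜 (littleO L)) =>
      toWeakSpace 𝕜 X (bidualToX hX hL (WeakDual.toStrongDual m)) := by
  refine WeakBilin.continuous_of_continuous_eval _ fun f => ?_
  exact (WeakDual.eval_continuous (restrictDual hL f)).congr fun m =>
    (apply_bidualToX hX hL (WeakDual.toStrongDual m) f).symm

lemma toX_bidualToBigO (hX : Reflexive 𝕜 X) (hL : NormStronger L)
    (m : StrongDual 𝕜 (StrongDual 𝕜 (littleO L))) :
    BigO.toX L (bidualToBigO hX hL m) = bidualToX hX hL m := rfl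

/-- `I` is the identity on `M₀`. -/
lemma bidualToBigO_inclusionInDoubleDual (hX : Reflexive 𝕜 X) (hL : NormStronger L)
    (u : littleO L) :
    bidualToBigO hX hL (NormedSpace.inclusionInDoubleDual 𝕜 (littleO L) u) = u := by
  refine BigO.toX_injective L ((SeparatingDual.eq_iff_forall_dual_eq (R := 𝕜)).2 fun f => ?_)
  rw [toX_bidualToBigO, apply_bidualToX]
  rfl

/-- The image under `I` of the closed unit ball of `M₀**`. -/
def bidualBall (hX : Reflexive 𝕜 X) (hL : NormStronger L) : Set (BigO L) :=
  bidualToBigO hX hL '' closedBall 0 1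

lemma coe_mem_bidualBall (hX : Reflexive 𝕜 X) (hL : NormStronger L) {u : littleO L}
    (hu : ‖u‖ ≤ 1) : (u : BigO L) ∈ bidualBall hX hL :=
  ⟨_, (mem_closedBall_zero_iff (E := StrongDual 𝕜 (StrongDual 𝕜 (littleO L)))).2
      ((NormedSpace.double_dual_bound 𝕜 (littleO L) u).trans hu),
    bidualToBigO_inclusionInDoubleDual hX hL u⟩

lemma WeakStarWeakContinuous.continuous_bidual {hX : Reflexive 𝕜 X} {hL : NormStronger L}
    {T : BigO L →L[𝕜] Z} (hT : WeakStarWeakContinuous hX hL T) :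
    Continuous fun m : WeakDual 𝕜 (StrongDual 𝕜 (littleO L)) =>
      toWeakSpace 𝕜 Z (T (bidualToBigO hX hL (WeakDual.toStrongDual m))) :=
  continuous_coinduced_dom (g := fun x => toWeakSpace 𝕜 Z (T x))
    (f := fun m => bidualToBigO hX hL (WeakDual.toStrongDual m)) |>.1 hT

/-- By weak* compactness, a weakly closed constraint on `T x` defines a closed subset of `X` as `x`
runs through the image of the closed unit ball of `M₀**`. -/
lemma WeakStarWeakContinuous.isClosed_toX_image {hX : Reflexive 𝕜 X} {hL : NormStronger L}
    {T : BigO L →L[𝕜] Z} (hT : WeakStarWeakContinuous hX hL T) {S : Set Z}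
    (hS : IsClosed (toWeakSpace 𝕜 Z '' S)) :
    IsClosed (BigO.toX L '' (bidualBall hX hL ∩ T ⁻¹' S)) := by
  have hK := (WeakDual.isCompact_closedBall (𝕜 := 𝕜)
    (0 : StrongDual 𝕜 (StrongDual 𝕜 (littleO L))) 1).inter_right
    (hS.preimage hT.continuous_bidual)
  -- The image is weakly compact, hence weakly closed, hence norm closed.
  have hI := (hK.image (continuous_toWeakSpace_bidualToX hX hL)).isClosed.preimage
    (toWeakSpaceCLM 𝕜 X).continuous
  convert hI using 1
  ext x
  constructor
  · rintro ⟨_, ⟨⟨m, hm, rfl⟩, hmS⟩, rfl⟩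
    exact ⟨StrongDual.toWeakDual m, ⟨hm, mem_image_of_mem _ hmS⟩, rfl⟩
  · rintro ⟨m, ⟨hm, hmS⟩, hx⟩
    exact ⟨_, ⟨⟨WeakDual.toStrongDual m, hm, rfl⟩,
      ((toWeakSpace 𝕜 Z).injective.mem_set_image (s := S)).1 hmS⟩,
      (toWeakSpace 𝕜 X).injective hx⟩

/-- A weakly closed constraint on `T x` passes from the unit ball of `M₀` to its closure in `X`. -/
lemma WeakStarWeakContinuous.mem_of_mem_closedUnitBall {hX : Reflexive 𝕜 X} {hL : NormStronger L}
    {T : BigO L →L[𝕜] Z} (hT : WeakStarWeakContinuous hX hL T) {S : Set Z}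
    (hS : IsClosed (toWeakSpace 𝕜 Z '' S)) {U : Set X} (hU : IsOpen U)
    (h : ∀ u : littleO L, ‖u‖ ≤ 1 → BigO.toX L u ∈ U → T u ∈ S) {x : BigO L}
    (hx : BigO.toX L x ∈ closedUnitBall L) (hxU : BigO.toX L x ∈ U) :
    x ∈ bidualBall hX hL ∧ T x ∈ S := by
  have hmem : BigO.toX L x ∈ BigO.toX L '' (bidualBall hX hL ∩ T ⁻¹' S) := by
    -- Since `U` is open, a point of `U` in the closure is a limit of points of the ball that lie in
    -- `U`.
    refine closure_minimal ?_ (hT.isClosed_toX_image hS) (hU.inter_closure ⟨hxU, hx⟩)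
    rintro _ ⟨huU, u, hu, rfl⟩
    have hu' : ‖u‖ ≤ 1 := by simpa using hu
    exact ⟨u, ⟨coe_mem_bidualBall hX hL hu', h u hu' huU⟩, rfl⟩
  exact ((BigO.toX_injective L).mem_set_image (s := bidualBall hX hL ∩ T ⁻¹' S)).1 hmem

/-- The image of the unit ball of `M₀**` is closed in `X` and contains the unit ball of `M₀`: this
is the previous lemma without a constraint. -/
lemma WeakStarWeakContinuous.mem_bidualBall {hX : Reflexive 𝕜 X} {hL : NormStronger L}
    {T : BigO L →L[𝕜] Z} (hT : WeakStarWeakContinuous hX hL T) {x : BigO L}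
    (hx : BigO.toX L x ∈ closedUnitBall L) : x ∈ bidualBall hX hL :=
  (hT.mem_of_mem_closedUnitBall (S := univ)
    (by rw [image_univ_of_surjective (toWeakSpace 𝕜 Z).surjective]; exact isClosed_univ)
    isOpen_univ (fun _ _ _ => mem_univ _) hx (mem_univ _)).1

/-- A vector in the closure in `X` of the unit ball of `M₀` comes from the unit ball of `M`. -/
lemma exists_toX_eq_of_mem_closedUnitBall {w : X} (hw : w ∈ closedUnitBall L) :
    ∃ x : BigO L, BigO.toX L x = w := by
  obtain ⟨x, hx, -⟩ := BigO.exists_toX_eq (L := L) (x := w) zero_le_one fun l => by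
    refine closure_minimal (t := {w | ‖L l w‖ ≤ 1}) ?_
      (isClosed_le (by fun_prop) continuous_const) hw
    rintro _ ⟨u, hu, rfl⟩
    exact (BigO.le_norm (u : BigO L) l).trans (by simpa using hu)
  exact ⟨x, hx⟩

/-- `T` maps the closure in `X` of the unit ball of `M₀` into a separable set. -/
lemma WeakStarWeakContinuous.exists_countable_dense [TopologicalSpace.SeparableSpace X]
    {hX : Reflexive 𝕜 X} {hL : NormStronger L}
    {T : BigO L →L[𝕜] Z} (hT : WeakStarWeakContinuous hX hL T) :
    ∃ D : Set Z, D.Countable ∧ ∀ x, BigO.toX L x ∈ closedUnitBall L → T x ∈ closure D := by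
  obtain ⟨c, hcW, hc, hWc⟩ := (TopologicalSpace.IsSeparable.of_separableSpace
    (closedUnitBall L)).exists_countable_dense_subset
  let c' : Set (BigO L) := BigO.toX L ⁻¹' c
  have hc' : c'.Countable := hc.preimage (BigO.toX_injective L)
  -- The closed span is separable and, being convex, weakly closed; so `T x ∈ S` passes from the
  -- dense set `c` to its closure.
  let S : Submodule 𝕜 Z := (Submodule.span 𝕜 (T '' c')).topologicalClosure
  have hSsep : TopologicalSpace.IsSeparable (S : Set Z) :=
    (hc'.image T).isSeparable.span.closure
  obtain ⟨D, -, hD, hSD⟩ := hSsep.exists_countable_dense_subset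
  refine ⟨D, hD, fun x hx => hSD ?_⟩
  have hclosed := hT.isClosed_toX_image
    (isClosed_toWeakSpace_submodule S (Submodule.isClosed_topologicalClosure _))
  have hmem : BigO.toX L x ∈ BigO.toX L '' (bidualBall hX hL ∩ T ⁻¹' S) := by
    refine closure_minimal ?_ hclosed (hWc hx)
    intro w hw
    obtain ⟨y, rfl⟩ := exists_toX_eq_of_mem_closedUnitBall (hcW hw)
    exact ⟨y, ⟨hT.mem_bidualBall (hcW hw), Submodule.le_topologicalClosure _
      (Submodule.subset_span ⟨y, hw, rfl⟩)⟩, rfl⟩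
  exact (((BigO.toX_injective L).mem_set_image (s := bidualBall hX hL ∩ T ⁻¹' S)).1 hmem).2

/-- Near some vector of the unit ball of `M₀`, the oscillation of `T` on that ball is small. -/
lemma WeakStarWeakContinuous.exists_norm_sub_le [CompleteSpace X]
    [TopologicalSpace.SeparableSpace X] {hX : Reflexive 𝕜 X} {hL : NormStronger L}
    {T : BigO L →L[𝕜] Z} (hT : WeakStarWeakContinuous hX hL T) {ε : ℝ} (hε : 0 < ε) :
    ∃ u₀ : littleO L, ‖u₀‖ ≤ 1 ∧ ∃ z : Z, ∃ δ > 0, ∀ u : littleO L, ‖u‖ ≤ 1 →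
      ‖BigO.toX L u - BigO.toX L u₀‖ < δ → ‖T u - z‖ ≤ ε := by
  obtain ⟨D, hD, hDT⟩ := hT.exists_countable_dense
  have := hD.to_subtype
  obtain ⟨z, w, hw, δ, hδ, hsub⟩ := exists_ball_inter_subset_of_isClosed_cover
    (isClosed_closure : IsClosed (closedUnitBall L))
    ⟨_, toX_mem_closedUnitBall (u := 0) (by simp)⟩
    (F := fun z : D => BigO.toX L '' (bidualBall hX hL ∩ T ⁻¹' closedBall (z : Z) ε))
    (fun z => hT.isClosed_toX_image (isClosed_toWeakSpace_closedBall 𝕜 _ _)) (fun w hw => by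
      obtain ⟨x, rfl⟩ := exists_toX_eq_of_mem_closedUnitBall hw
      obtain ⟨z, hz, hxz⟩ := Metric.mem_closure_iff.1 (hDT x hw) ε hε
      exact mem_iUnion.2 ⟨⟨z, hz⟩, x, ⟨hT.mem_bidualBall hw, hxz.le⟩, rfl⟩)
  -- The Baire point `w` need not come from `M₀`; half of `δ` pays for replacing it by `u₀`.
  obtain ⟨_, ⟨u₀, hu₀, rfl⟩, hwu⟩ := Metric.mem_closure_iff.1 hw (δ / 2) (half_pos hδ)
  refine ⟨u₀, by simpa using hu₀, z, δ / 2, half_pos hδ, fun u hu hlt => ?_⟩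
  have hmem := hsub ⟨?_, toX_mem_closedUnitBall hu⟩
  · have h := (((BigO.toX_injective L).mem_set_image
      (s := bidualBall hX hL ∩ T ⁻¹' closedBall (z : Z) ε)).1 hmem).2
    simpa [dist_eq_norm] using h
  · rw [← dist_eq_norm] at hlt
    rw [dist_comm] at hwu
    rw [mem_ball]
    linarith [dist_triangle (BigO.toX L u) (BigO.toX L u₀) w]

/-- On the unit ball of `M₀`, the operator `T` is small where the norm of `X` is small. -/
lemma WeakStarWeakContinuous.exists_norm_le [CompleteSpace X]
    [TopologicalSpace.SeparableSpace X] {hX : Reflexive 𝕜 X} {hL : NormStronger L}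
    (hcont : ∀ x : X, Continuous fun l => L l x)
    {T : BigO L →L[𝕜] Z} (hT : WeakStarWeakContinuous hX hL T) {ε : ℝ} (hε : 0 < ε) :
    ∃ δ > 0, ∀ u : littleO L, ‖u‖ ≤ 1 → ‖BigO.toX L u‖ < δ → ‖T u‖ ≤ ε := by
  -- Two errors `ε / 4` and the factor `1 + η ≤ 2` from undoing the rescaling add up to at most `ε`.
  obtain ⟨u₀, hu₀, z, δ, hδ, hz⟩ := hT.exists_norm_sub_le (ε := ε / 4) (by positivity)
  set a : ℝ := ‖BigO.toX L u₀‖ with ha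
  have ha0 : 0 ≤ a := norm_nonneg _
  -- Rescaling `u₀` by `(1 + η)⁻¹` moves it by at most `η * a` in `X`; the other half of `δ` is left
  -- for `u`.
  obtain ⟨η, hη0, hη1, hηδ⟩ : ∃ η : ℝ, 0 < η ∧ η ≤ 1 ∧ η * a < δ / 2 := by
    refine ⟨min 1 (δ / (2 * (a + 1))), by positivity, min_le_left _ _, ?_⟩
    calc min 1 (δ / (2 * (a + 1))) * a ≤ δ / (2 * (a + 1)) * a := by
          gcongr; exact min_le_right _ _
      _ < δ / (2 * (a + 1)) * (a + 1) := by gcongr; linarith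
      _ = δ / 2 := by field_simp
  obtain ⟨δ', hδ', hadd⟩ := exists_norm_add_le hcont u₀ hu₀ hη0
  refine ⟨min δ' (δ / 2), by positivity, fun u hu hlt => ?_⟩
  have hη : 0 < 1 + η := by positivity
  let t : 𝕜 := ((1 + η : ℝ) : 𝕜)⁻¹
  have ht : ‖t‖ = (1 + η)⁻¹ := by rw [norm_inv, RCLike.norm_of_nonneg hη.le]
  have ht1 : ‖t - 1‖ ≤ η := by
    have h : t - 1 = ((-(η / (1 + η)) : ℝ) : 𝕜) := by
      have h' : (1 + η)⁻¹ - 1 = -(η / (1 + η)) := by field_simp; ring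
      rw [← h', RCLike.ofReal_sub, RCLike.ofReal_inv, RCLike.ofReal_one]
    rw [h, RCLike.norm_ofReal, abs_neg, abs_of_nonneg (by positivity)]
    exact div_le_self hη0.le (by linarith)
  have h1 := hz (t • u₀) (by
    rw [norm_smul, ht, inv_mul_le_one₀ hη]; linarith) (by
    have h : BigO.toX L (t • u₀ : littleO L) - BigO.toX L u₀ = (t - 1) • BigO.toX L u₀ := by
      simp [sub_smul]
    rw [h, norm_smul]
    nlinarith)
  have h2 := hz (t • (u₀ + u)) (by
    rw [norm_smul, ht, inv_mul_le_one₀ hη]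
    exact hadd u hu (hlt.trans_le (min_le_left _ _))) (by
    have h : BigO.toX L (t • (u₀ + u) : littleO L) - BigO.toX L u₀
        = (t - 1) • BigO.toX L u₀ + t • BigO.toX L u := by
      simp only [Submodule.coe_smul, Submodule.coe_add, map_smul, map_add]
      module
    have h3 : ‖t • BigO.toX L u‖ < δ / 2 := by
      rw [norm_smul, ht]
      exact (mul_le_of_le_one_left (norm_nonneg _) (inv_le_one_of_one_le₀ (by linarith))).trans_lt
        (hlt.trans_le (min_le_right _ _))
    rw [h]
    refine (norm_add_le _ _).trans_lt ?_
    rw [norm_smul]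
    nlinarith)
  have h4 : T (t • (u₀ + u) : littleO L) - z - (T (t • u₀ : littleO L) - z) = t • T u := by
    simp only [Submodule.coe_smul, Submodule.coe_add, map_smul, map_add]
    module
  have h5 := (norm_sub_le _ _).trans (add_le_add h2 h1)
  rw [h4, norm_smul, ht, inv_mul_le_iff₀ hη] at h5
  nlinarith

end WeakStar

/-! ### Weak compactness and the estimate on `M` -/

section Main

variable {𝕜 X Y Z Λ : Type*} [RCLike 𝕜]
  [NormedAddCommGroup X] [NormedSpace 𝕜 X] [CompleteSpace X]
  [NormedAddCommGroup Y] [NormedSpace 𝕜 Y]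
  [NormedAddCommGroup Z] [NormedSpace 𝕜 Z] [TopologicalSpace Λ] {L : Λ → X →L[𝕜] Y}

/-- Weak*-weak continuity transports the weak* compactness of the balls of `M₀**` to `Z`. -/
lemma WeakStarWeakContinuous.weaklyCompact {hX : Reflexive 𝕜 X} {hL : NormStronger L}
    (happrox : Approximation L) {T : BigO L →L[𝕜] Z} (hT : WeakStarWeakContinuous hX hL T) :
    WeaklyCompact T := by
  obtain ⟨r, hr, hball⟩ := exists_closedBall_subset_closedUnitBall hL happrox
  refine ((WeakDual.isCompact_closedBall (𝕜 := 𝕜)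
    (0 : StrongDual 𝕜 (StrongDual 𝕜 (littleO L))) r⁻¹).image
      hT.continuous_bidual).closure_of_subset ?_
  rintro _ ⟨x, hx, rfl⟩
  have hr' : (r : 𝕜) ≠ 0 := by exact_mod_cast hr.ne'
  obtain ⟨m, hm, hmx⟩ := hT.mem_bidualBall (hball ((r : 𝕜) • x) (by
    rw [norm_smul, RCLike.norm_of_nonneg hr.le]
    exact mul_le_of_le_one_right hr.le (by simpa using hx)))
  refine ⟨StrongDual.toWeakDual ((r : 𝕜)⁻¹ • m), ?_, ?_⟩
  · have hm1 : ‖m‖ ≤ 1 :=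
      (mem_closedBall_zero_iff (E := StrongDual 𝕜 (StrongDual 𝕜 (littleO L)))).1 hm
    have h : ‖(r : 𝕜)⁻¹ • m‖ ≤ r⁻¹ := by
      refine (ContinuousLinearMap.opNorm_smul_le _ _).trans ?_
      rw [norm_inv, RCLike.norm_of_nonneg hr.le]
      exact mul_le_of_le_one_right (by positivity) hm1
    exact (mem_closedBall_zero_iff (E := StrongDual 𝕜 (StrongDual 𝕜 (littleO L)))).2 h
  · change toWeakSpace 𝕜 Z (T (bidualToBigO hX hL ((r : 𝕜)⁻¹ • m))) = _
    rw [map_smul, hmx, smul_smul, inv_mul_cancel₀ hr', one_smul]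

/-- The estimate of `‖T x‖` by the norm of `X`, up to a small multiple of the norm of `M`. The weak
compactness of `T` enters through the weak* compactness of the balls of `M₀**`. -/
lemma WeakStarWeakContinuous.exists_norm_le_add [TopologicalSpace.SeparableSpace X]
    {hX : Reflexive 𝕜 X} {hL : NormStronger L} (hcont : ∀ x : X, Continuous fun l => L l x)
    (happrox : Approximation L) {T : BigO L →L[𝕜] Z} (hT : WeakStarWeakContinuous hX hL T)
    {ε : ℝ} (hε : 0 < ε) :
    ∃ N : ℝ, 0 < N ∧ ∀ x : BigO L, ‖T x‖ ≤ N * ‖BigO.toX L x‖ + ε * ‖x‖ := by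
  obtain ⟨r, hr, hball⟩ := exists_closedBall_subset_closedUnitBall hL happrox
  obtain ⟨δ, hδ, hsmall⟩ := hT.exists_norm_le hcont (ε := ε * r) (by positivity)
  refine ⟨(‖T‖ + 1) * r / δ, by positivity, fun x => ?_⟩
  have hT0 := norm_nonneg T
  rcases (norm_nonneg x).eq_or_lt with hx0 | hx0
  · have h := T.le_opNorm x
    rw [← hx0, mul_zero] at h
    rw [← hx0, mul_zero, add_zero]
    exact h.trans (by positivity)
  have hs : 0 < r / ‖x‖ := by positivity
  have hnorm : ‖((r / ‖x‖ : ℝ) : 𝕜)‖ = r / ‖x‖ := RCLike.norm_of_nonneg hs.le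
  -- Rescaled to norm `r`, the vector `x` lies in `closedUnitBall L`. If it is small in `X`, the
  -- bound on `M₀` passes to it; otherwise `‖x‖` is at most `r / δ` times its norm in `X`, which
  -- gives `N`.
  rcases lt_or_ge (r / ‖x‖ * ‖BigO.toX L x‖) δ with hlt | hge
  · have h := (hT.mem_of_mem_closedUnitBall (isClosed_toWeakSpace_closedBall 𝕜 0 (ε * r))
      isOpen_ball (fun u hu huU => mem_closedBall_zero_iff.2
        (hsmall u hu (mem_ball_zero_iff.1 huU)))
      (hball (((r / ‖x‖ : ℝ) : 𝕜) • x)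
        (by rw [norm_smul, hnorm, div_mul_cancel₀ _ hx0.ne']))
      (mem_ball_zero_iff.2 (by rwa [map_smul, norm_smul, hnorm]))).2
    rw [mem_closedBall_zero_iff, map_smul, norm_smul, hnorm, div_mul_eq_mul_div,
      div_le_iff₀ hx0] at h
    have h' : ‖T x‖ ≤ ε * ‖x‖ := by
      refine le_of_mul_le_mul_left ?_ hr
      linarith
    exact h'.trans (le_add_of_nonneg_left (by positivity))
  · rw [div_mul_eq_mul_div, le_div_iff₀ hx0] at hge
    have hx : ‖x‖ ≤ r * ‖BigO.toX L x‖ / δ := by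
      rw [le_div_iff₀ hδ]; linarith
    calc ‖T x‖ ≤ ‖T‖ * ‖x‖ := T.le_opNorm x
      _ ≤ (‖T‖ + 1) * (r * ‖BigO.toX L x‖ / δ) := by gcongr; linarith
      _ = (‖T‖ + 1) * r / δ * ‖BigO.toX L x‖ := by ring
      _ ≤ _ := le_add_of_nonneg_right (by positivity)

end Main

end OOSpace

end

theorem corollary3p3 {𝕜 X Y Z Λ : Type*} [RCLike 𝕜]
    [NormedAddCommGroup X] [NormedSpace 𝕜 X] [CompleteSpace X] [TopologicalSpace.SeparableSpace X]
    [NormedAddCommGroup Y] [NormedSpace 𝕜 Y] [CompleteSpace Y]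
    [NormedAddCommGroup Z] [NormedSpace 𝕜 Z] [CompleteSpace Z]
    [TopologicalSpace Λ] [T2Space Λ] [LocallyCompactSpace Λ] [SigmaCompactSpace Λ]
    (hX : OOSpace.Reflexive 𝕜 X)
    (L : Λ → X →L[𝕜] Y) (hcont : ∀ x : X, Continuous fun l => L l x)
    (hL : OOSpace.NormStronger L) (happrox : OOSpace.Approximation L)
    (T : OOSpace.BigO L →L[𝕜] Z) (hT : OOSpace.WeakStarWeakContinuous hX hL T) :
    OOSpace.WeaklyCompact T ↔
      ∀ ε : ℝ, 0 < ε → ∃ N : ℝ, 0 < N ∧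
        ∀ x : OOSpace.BigO L, ‖T x‖ ≤ N * ‖OOSpace.BigO.toX L x‖ + ε * ‖x‖ := by
  exact ⟨fun _ _ hε => hT.exists_norm_le_add hcont happrox hε,
    fun _ => hT.weaklyCompact happrox⟩
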